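/- Let $H$ be a finite dimensional semisimple Hopf algebra, with counit $\varepsilon$, comultiplication $\Delta(h)=h_{(1)}\otimes h_{(2)}$ and antipode $S$, over an algebraically closed field $\Bbbk$ whose characteristic is either $0$ or a prime $p>\dim_{\Bbbk}(H)^{1/2}$. Let $\Lambda$ be a left integral of $H$ (that is, $h\Lambda=\varepsilon(h)\Lambda$ for all $h\in H$) and let $\lambda$ be a right integral of $H^*$ (that is, $\lambda * f=f(1)\lambda$ for all $f\in H^*$, where $*$ is the convolution product) such that $\lambda(\Lambda)=1$. Let $\{V_i\}_{i\in I}$ be a complete set of pairwise non-isomorphic simple left $H$-modules, indexed by a finite set $I$, and for each $i$ let $e_i$ be the central primitive idempotent of $H$ which acts as the identity on $V_i$. Put $$\mathbf{u}:=S(\Lambda_{(2)})\Lambda_{(1)}\in H .$$ (1) The element $\mathbf{u}$ is a unit of $H$, and $S^2(h)=\mathbf{u}h\mathbf{u}^{-1}$ for all $h\in H$. (2) Let $u$ be any unit of $H$ satisfying $S^2(h)=uhu^{-1}$ for all $h\in H$. For each $i\in I$ there is a unique $c_i\in\Bbbk$, the Schur element of $V_i$ associated to the dual basis $\Lambda_{(1)}\otimes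 u^{-1}S(\Lambda_{(2)})$, such that $$\Lambda_{(1)}\,\varphi\big(u^{-1}S(\Lambda_{(2)})v\big)=c_i\,\mathrm{tr}(\varphi)\,v\qquad\text{for all }\varphi\in\mathrm{End}_{\Bbbk}(V_i),\ v\in V_i,$$ and $$\mathbf{u}=u\sum_{i\in I}\dim_{\Bbbk}(V_i)\,c_i\,e_i .$$ -/

import Mathlib

open scoped TensorProduct

namespace HopfSchur

section Integrals

variable (k : Type*) {H : Type*} [Field k] [Ring H] [HopfAlgebra k H]

/-- `Λ` is a left integral of `H`: `h Λ = ε(h) Λ` for all `h`. -/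
def IsLeftIntegral (Λ : H) : Prop :=
  ∀ h : H, h * Λ = Coalgebra.counit (R := k) h • Λ

variable {k}

/-- `lam` is a right integral of the dual Hopf algebra `H*`: `lam * f = f(1) lam` for all `f ∈ H*`.
The product of `H*` is the convolution product, the counit of `H*` is evaluation at `1`. -/
def IsRightIntegralDual (lam : Module.Dual k H) : Prop :=
  ∀ f : Module.Dual k H,
    WithConv.toConv lam * WithConv.toConv f = f 1 • WithConv.toConv lam

variable (k)

/-- The element `S(Λ₍₂₎) Λ₍₁₎` of `H`. -/
noncomputable def antipodeMulSwap (Λ : H) : H :=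
  LinearMap.mul' k H
    (TensorProduct.map (HopfAlgebra.antipode k) LinearMap.id
      (TensorProduct.comm k H H (Coalgebra.comul (R := k) Λ)))

/-- Sweedler form of the definition. -/
theorem antipodeMulSwap_eq_sum {κ : Type*} (Λ : H) (r : Coalgebra.Repr k Λ κ) :
    antipodeMulSwap k Λ =
      ∑ i ∈ r.index, HopfAlgebra.antipode k (r.right i) * r.left i := by
  simp [antipodeMulSwap, ← r.eq]

end Integrals

section Schur

variable {k H : Type*} [Field k] [Ring H] [HopfAlgebra k H]
variable {V : Type*} [AddCommGroup V] [Module k V] [Module H V] [IsScalarTower k H V]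

/-- The `k`-linear endomorphism `v ↦ Λ₍₁₎ φ(u⁻¹ S(Λ₍₂₎) v)` of the `H`-module `V`. -/
noncomputable def casimirMap (Λ : H) (u : Hˣ) (φ : Module.End k V) : Module.End k V :=
  TensorProduct.lift
    ((LinearMap.mul k (Module.End k V)).compl₁₂
      (Algebra.lsmul k k V : H →ₐ[k] Module.End k V).toLinearMap
      (LinearMap.mulLeft k φ ∘ₗ
        (Algebra.lsmul k k V : H →ₐ[k] Module.End k V).toLinearMap ∘ₗ
        LinearMap.mulLeft k ((u⁻¹ : Hˣ) : H) ∘ₗ HopfAlgebra.antipode k))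
    (Coalgebra.comul (R := k) Λ)

/-- Sweedler form of the definition. -/
theorem casimirMap_apply {κ : Type*} (Λ : H) (u : Hˣ) (φ : Module.End k V)
    (r : Coalgebra.Repr k Λ κ) (v : V) :
    casimirMap Λ u φ v =
      ∑ i ∈ r.index,
        r.left i • φ ((((u⁻¹ : Hˣ) : H) * HopfAlgebra.antipode k (r.right i)) • v) := by
  simp [casimirMap, ← r.eq, LinearMap.sum_apply, mul_smul]

variable (V) in
/-- `c` is the Schur element of the simple module `V` associated to the dual basis
`Λ₍₁₎ ⊗ u⁻¹ S(Λ₍₂₎)`: `Λ₍₁₎ φ(u⁻¹ S(Λ₍₂₎) v) = c tr(φ) v` for all `φ ∈ End_k(V)` and `v ∈ V`. -/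
def IsSchurElement (Λ : H) (u : Hˣ) (c : k) : Prop :=
  ∀ φ : Module.End k V,
    casimirMap Λ u φ = (c * LinearMap.trace k V φ) • (LinearMap.id : Module.End k V)

end Schur

section Simple

universe v w

/-- `V` is a complete irredundant list of the simple left `H`-modules up to isomorphism.
(Every simple `H`-module is a quotient of `H`, so it has a copy in the universe of `H`.) -/
structure IsCompleteSimpleFamily (H : Type v) [Ring H] {ι : Type*} (V : ι → Type w)
    [∀ i, AddCommGroup (V i)] [∀ i, Module H (V i)] : Prop where
  simple : ∀ i, IsSimpleModule H (V i)
  not_iso : ∀ i j, Nonempty (V i ≃ₗ[H] V j) → i = j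
  complete : ∀ (W : Type v) [AddCommGroup W] [Module H W], IsSimpleModule H W →
    ∃ i, Nonempty (W ≃ₗ[H] V i)

/-- `e` is a central primitive idempotent: a nonzero central idempotent that is not the sum of two
nonzero orthogonal central idempotents. -/
structure IsCentralPrimitiveIdempotent {H : Type*} [Ring H] (e : H) : Prop where
  idem : IsIdempotentElem e
  central : e ∈ Subring.center H
  ne_zero : e ≠ 0
  primitive : ∀ f g : H, IsIdempotentElem f → IsIdempotentElem g →
    f ∈ Subring.center H → g ∈ Subring.center H → f * g = 0 → e = f + g → f = 0 ∨ g = 0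

end Simple

end HopfSchur

/-!
Write `U = S(Λ₍₂₎) Λ₍₁₎`. As `lam Λ = 1`, the integral `Λ` is nonzero; semisimplicity then
gives `ε(Λ) ≠ 0` and makes `Λ` two-sided. The left integral property makes `Λ₍₁₎ ⊗ S(Λ₍₂₎)` a
Casimir tensor, that is
`h Λ₍₁₎ ⊗ S(Λ₍₂₎) = Λ₍₁₎ ⊗ S(Λ₍₂₎) h` (`IsLeftIntegral.map_mulLeft`), and the right integral
property gives `U h = S²(h) U` (`IsLeftIntegral.antipodeMulSwap_mul`).

On a simple module `V` the map `φ ↦ Λ₍₁₎ φ S(Λ₍₂₎)` therefore takes values in `End_H(V) = k`, and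
cyclicity of the trace identifies it: `tr(Λ₍₁₎ φ S(Λ₍₂₎)) = tr(φ U)` (`trace_casimirMap`). For
`φ = 1` this reads `tr_V(U) = ε(Λ) dim V`. By density `(dim V)² ≤ dim H`, so the assumption on the
characteristic makes `dim V` nonzero in `k`, and `U` acts as a nonzero map on every simple module.
The relation `U h = S²(h) U` shows that `{h | U h = 0}` is a left ideal; it contains no simple left
ideal, hence vanishes, and `U` is a unit (`isUnit_antipodeMulSwap`).

If a unit `u` also implements `S²`, then `u⁻¹ U` is central and acts on `V i` by a scalar `ζ i`. The
trace identity with `φ u⁻¹` in place of `φ` shows that the Schur element is `ζ i / dim (V i)`.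
Finally `u⁻¹ U` and `∑ i, ζ i • e i` act alike on all simple modules, hence are equal, once it is
known that `e i` kills `V j` for `j ≠ i` (`IsCentralPrimitiveIdempotent.smul_eq_zero`).
-/

namespace HopfSchur

/-! ### Ideals and idempotents of semisimple rings -/

section SemisimpleRing

variable {R : Type*} [Ring R] [IsSemisimpleRing R]

/-- A semisimple ring is semiprime: an idempotent generator of the left ideal `R y` has
square zero. -/
theorem eq_zero_of_forall_mul_mul_eq_zero {y : R} (hy : ∀ r, y * r * y = 0) : y = 0 := by
  obtain ⟨q, hq, hspan⟩ := IsSemisimpleRing.ideal_eq_span_idempotent (Ideal.span {y})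
  have hyq : y ∈ Ideal.span {q} := hspan ▸ Ideal.mem_span_singleton_self y
  have hqy : q ∈ Ideal.span {y} := hspan ▸ Ideal.mem_span_singleton_self q
  obtain ⟨a, ha⟩ := Ideal.mem_span_singleton'.1 hqy
  obtain ⟨b, hb⟩ := Ideal.mem_span_singleton'.1 hyq
  have hq0 : q = 0 := by
    rw [← hq.eq, ← ha, mul_assoc, ← mul_assoc y, hy, mul_zero]
  rw [← hb, hq0, mul_zero]

theorem exists_central_idempotent_of_isTwoSided (A : Ideal R) [A.IsTwoSided] :
    ∃ g ∈ A, IsIdempotentElem g ∧ g ∈ Subring.center R ∧ ∀ a ∈ A, a * g = a := by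
  obtain ⟨g, hg, rfl⟩ := IsSemisimpleRing.ideal_eq_span_idempotent A
  have hmul : ∀ a ∈ Ideal.span {g}, a * g = a := by
    intro a ha
    obtain ⟨b, rfl⟩ := Ideal.mem_span_singleton'.1 ha
    rw [mul_assoc, hg.eq]
  have hgA : g ∈ Ideal.span {g} := Ideal.mem_span_singleton_self g
  have hright : ∀ r, g * r * g = g * r := fun r => hmul _ (Ideal.mul_mem_right r _ hgA)
  refine ⟨g, hgA, hg, Subring.mem_center_iff.2 fun h => ?_, hmul⟩
  -- `y = (1 - g) h g` satisfies `y R y = 0`, because `g R (1 - g) = 0` by `hright`.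
  have hz : h * g - g * h * g = 0 := by
    apply eq_zero_of_forall_mul_mul_eq_zero
    intro r
    have h3 := hright r
    simp only [mul_sub, sub_mul, mul_assoc] at h3 ⊢
    have h4 : g * (r * (g * (h * g))) = g * (r * (h * g)) := by
      rw [← mul_assoc r g, ← mul_assoc g, ← mul_assoc g r g, mul_assoc g r g, h3, mul_assoc]
    rw [h4]
    simp
  rw [sub_eq_zero.1 hz, hright]

/-- A simple module over a semisimple ring is determined up to isomorphism by its annihilator. A
simple left ideal `L ≅ W` is not contained in `Ann V`, because the central idempotent generating
`Ann V` annihilates `L`; so some `l ↦ l • v` is a nonzero map `L → V`. -/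
theorem nonempty_linearEquiv_of_annihilator_le {V W : Type*} [AddCommGroup V] [Module R V]
    [AddCommGroup W] [Module R W] [IsSimpleModule R V] [IsSimpleModule R W]
    (hVW : Module.annihilator R V ≤ Module.annihilator R W) : Nonempty (V ≃ₗ[R] W) := by
  obtain ⟨g, hgA, -, hgc, hg⟩ :=
    exists_central_idempotent_of_isTwoSided (Module.annihilator R V)
  obtain ⟨L, ⟨f⟩⟩ := IsSemisimpleRing.exists_linearEquiv_ideal_of_isSimpleModule R W
  have := IsSimpleModule.congr f.symm
  have hgL : ∀ l : L, g • l = 0 := fun l => by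
    rw [← f.apply_symm_apply l, ← map_smul, Module.mem_annihilator.1 (hVW hgA), map_zero]
  have hex : ∃ v : V, LinearMap.toSpanSingleton R V v ∘ₗ L.subtype ≠ 0 := by
    by_contra! hcon
    have := IsSimpleModule.nontrivial R L
    obtain ⟨l, hl⟩ := exists_ne (0 : L)
    refine hl (Subtype.ext ?_)
    have hlA : (l : R) ∈ Module.annihilator R V :=
      Module.mem_annihilator.2 fun v => by simpa using congr($(hcon v) l)
    have := congrArg Subtype.val (hgL l)
    rw [← hg _ hlA, Subring.mem_center_iff.1 hgc]
    simpa using this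
  obtain ⟨v, hv⟩ := hex
  exact ⟨(f.trans (LinearEquiv.ofBijective _ (LinearMap.bijective_of_ne_zero hv))).symm⟩

/-- A central primitive idempotent that is the identity on a simple module `V` kills every other
simple module. With `g` the central idempotent generating `Ann V`, primitivity forces `e g = 0`. -/
theorem IsCentralPrimitiveIdempotent.smul_eq_zero {e : R} (he : IsCentralPrimitiveIdempotent e)
    {V W : Type*} [AddCommGroup V] [Module R V] [AddCommGroup W] [Module R W]
    [IsSimpleModule R V] [IsSimpleModule R W] (heV : ∀ v : V, e • v = v)
    (hVW : IsEmpty (V ≃ₗ[R] W)) (w : W) : e • w = 0 := by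
  obtain ⟨g, hgA, hgi, hgc, hg⟩ :=
    exists_central_idempotent_of_isTwoSided (Module.annihilator R V)
  have hge : g * e = e * g := Subring.mem_center_iff.1 he.central g
  have hgR : ∀ r, r * g = g * r := Subring.mem_center_iff.1 hgc
  have hgV : ∀ v : V, g • v = 0 := Module.mem_annihilator.1 hgA
  have hsplit : e * g = 0 ∨ e * (1 - g) = 0 := by
    refine he.primitive _ _ (he.idem.mul_of_commute hge.symm hgi)
      (he.idem.mul_of_commute ?_ hgi.one_sub) (Subring.mul_mem _ he.central hgc)
      (Subring.mul_mem _ he.central (Subring.sub_mem _ (Subring.one_mem _) hgc)) ?_ ?_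
    · rw [commute_iff_eq, mul_sub, sub_mul, hge, one_mul, mul_one]
    · rw [← mul_assoc, mul_assoc e g e, hge, mul_assoc, mul_assoc, mul_sub, hgi.eq]
      simp
    · rw [← mul_add]; simp
  rcases hsplit with h | h
  -- If `e` does not kill `W`, then `e • w` generates `W`. As `g` kills `e • w`, it kills `W`, so
  -- `Ann V ≤ Ann W`.
  · by_contra hw
    refine hVW.false (nonempty_linearEquiv_of_annihilator_le fun a ha => ?_).some
    have hs : ∀ w : W, g • e • w = 0 := fun w => by rw [← mul_smul, hge, h, zero_smul]
    refine Module.mem_annihilator.2 fun x => ?_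
    obtain ⟨r, rfl⟩ := IsSimpleModule.toSpanSingleton_surjective R hw x
    rw [LinearMap.toSpanSingleton_apply, ← hg a ha, mul_smul, ← mul_smul g r, ← hgR, mul_smul,
      hs, smul_zero, smul_zero]
  · exfalso
    have := IsSimpleModule.nontrivial R V
    obtain ⟨v, hv⟩ := exists_ne (0 : V)
    refine hv ?_
    have := congrArg (· • v) h
    simpa [mul_smul, sub_smul, hgV, heV] using this

theorem eq_zero_of_forall_simple_smul_eq_zero {x : R}
    (hx : ∀ L : Ideal R, IsSimpleModule R L → ∀ l ∈ L, x * l = 0) : x = 0 := by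
  suffices h : ∀ r ∈ sSup {L : Ideal R | IsSimpleModule R L}, x * r = 0 by
    rw [← mul_one x]
    exact h 1 (by rw [IsSemisimpleModule.sSup_simples_eq_top]; trivial)
  intro r hr
  rw [sSup_eq_iSup'] at hr
  induction hr using Submodule.iSup_induction' with
  | mem L l hl => exact hx L L.2 l hl
  | zero => exact mul_zero x
  | add a b _ _ ha hb => rw [mul_add, ha, hb, add_zero]

end SemisimpleRing

/-! ### Integrals of Hopf algebras -/

section HopfAlgebra

open Coalgebra HopfAlgebra TensorProduct

variable {k H : Type*} [Field k] [Ring H] [HopfAlgebra k H] {Λ : H}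

theorem sum_counit_right_smul_left {C κ : Type*} [AddCommGroup C] [Module k C] [Coalgebra k C]
    {a : C} (r : Coalgebra.Repr k a κ) :
    ∑ i ∈ r.index, counit (R := k) (r.right i) • r.left i = a := by
  have h := congrArg (TensorProduct.rid k C) (sum_tmul_counit_eq r)
  simp only [map_sum, TensorProduct.rid_tmul, one_smul] at h
  exact h

/-- The Casimir property `h Λ₍₁₎ ⊗ S(Λ₍₂₎) = Λ₍₁₎ ⊗ S(Λ₍₂₎) h` of a left integral. Both sides equal
`h₍₁₎ Λ₍₁₎ ⊗ S(Λ₍₂₎) S(h₍₂₎) h₍₃₎`. -/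
theorem IsLeftIntegral.map_mulLeft (hΛ : IsLeftIntegral k Λ) (h : H) :
    TensorProduct.map (LinearMap.mulLeft k h) (antipode k) (comul (R := k) Λ) =
      TensorProduct.map LinearMap.id (LinearMap.mulRight k h ∘ₗ antipode k)
        (comul (R := k) Λ) := by
  let r := ℛ k Λ
  let s := ℛ k h
  -- `T (a ⊗ b ⊗ c) = a Λ₍₁₎ ⊗ S(Λ₍₂₎) S(b) c` is evaluated on the two bracketings of
  -- `h₍₁₎ ⊗ h₍₂₎ ⊗ h₍₃₎`.
  let T : H ⊗[k] (H ⊗[k] H) →ₗ[k] H ⊗[k] H := ∑ i ∈ r.index,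
    TensorProduct.map (LinearMap.mulRight k (r.left i))
      (LinearMap.mulLeft k (antipode k (r.right i)) ∘ₗ LinearMap.mul' k H ∘ₗ
        TensorProduct.map (antipode k) LinearMap.id)
  have key := congrArg T
    (sum_tmul_tmul_eq s (fun j => ℛ k (s.left j)) (fun j => ℛ k (s.right j)))
  have hR : T (∑ j ∈ s.index, ∑ m ∈ (ℛ k (s.right j)).index,
      s.left j ⊗ₜ[k] ((ℛ k (s.right j)).left m ⊗ₜ[k] (ℛ k (s.right j)).right m)) =
      TensorProduct.map (LinearMap.mulLeft k h) (antipode k) (comul (R := k) Λ) := by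
    have hc := sum_counit_right_smul_left s
    simp only [T, LinearMap.sum_apply, map_sum, TensorProduct.map_tmul, LinearMap.mulRight_apply,
      LinearMap.comp_apply, LinearMap.mul'_apply, LinearMap.id_apply, LinearMap.mulLeft_apply]
    rw [← r.eq]
    simp only [map_sum, TensorProduct.map_tmul, LinearMap.mulLeft_apply]
    rw [Finset.sum_congr rfl fun _ _ => Finset.sum_comm, Finset.sum_comm]
    refine Finset.sum_congr rfl fun i _ => ?_
    simp only [← TensorProduct.tmul_sum, ← Finset.mul_sum, sum_antipode_mul_eq_smul,
      mul_smul_comm, mul_one, TensorProduct.tmul_smul, TensorProduct.smul_tmul']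
    conv_rhs => rw [← hc]
    simp only [Finset.sum_mul, TensorProduct.sum_tmul, smul_mul_assoc]
  have hL : T (∑ j ∈ s.index, ∑ m ∈ (ℛ k (s.left j)).index,
      (ℛ k (s.left j)).left m ⊗ₜ[k] ((ℛ k (s.left j)).right m ⊗ₜ[k] s.right j)) =
      TensorProduct.map LinearMap.id (LinearMap.mulRight k h ∘ₗ antipode k)
        (comul (R := k) Λ) := by
    have hj : ∀ j, T (∑ m ∈ (ℛ k (s.left j)).index,
        (ℛ k (s.left j)).left m ⊗ₜ[k] ((ℛ k (s.left j)).right m ⊗ₜ[k] s.right j)) =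
        counit (R := k) (s.left j) • TensorProduct.map LinearMap.id
          (LinearMap.mulRight k (s.right j) ∘ₗ antipode k) (comul (R := k) Λ) := by
      intro j
      rw [← LinearMap.map_smul, ← LinearMap.map_smul, ← hΛ, Bialgebra.comul_mul,
        ← (ℛ k (s.left j)).eq, ← r.eq]
      simp only [T, LinearMap.sum_apply, map_sum, TensorProduct.map_tmul,
        LinearMap.mulRight_apply, Finset.sum_mul, Finset.mul_sum,
        Algebra.TensorProduct.tmul_mul_tmul, antipode_mul_antidistrib,
        LinearMap.comp_apply, LinearMap.mul'_apply, LinearMap.id_apply, LinearMap.mulLeft_apply,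
        mul_assoc]
      exact Finset.sum_comm
    have hc : ∑ j ∈ s.index, (counit (R := k) (s.left j)) • s.right j = h := sum_counit_smul s
    rw [map_sum]
    simp only [hj]
    rw [← r.eq]
    simp only [map_sum, TensorProduct.map_tmul, LinearMap.mulRight_apply, Finset.smul_sum,
        LinearMap.comp_apply, LinearMap.id_apply]
    rw [Finset.sum_comm]
    refine Finset.sum_congr rfl fun i _ => ?_
    conv_rhs => rw [← hc]
    rw [Finset.mul_sum, TensorProduct.tmul_sum]
    simp
  rw [← hR, ← hL, key]

/-- For a right integral, `Λ₍₁₎ h ⊗ Λ₍₂₎ = Λ₍₁₎ ⊗ Λ₍₂₎ S(h)`. Both sides equal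
`Λ₍₁₎ h₍₁₎ ⊗ Λ₍₂₎ h₍₂₎ S(h₍₃₎)`. -/
theorem map_mulRight_of_isRightIntegral (hΛ : ∀ h : H, Λ * h = counit (R := k) h • Λ) (h : H) :
    TensorProduct.map (LinearMap.mulRight k h) LinearMap.id (comul (R := k) Λ) =
      TensorProduct.map LinearMap.id (LinearMap.mulRight k (antipode k h))
        (comul (R := k) Λ) := by
  let r := ℛ k Λ
  let s := ℛ k h
  -- `T (a ⊗ b ⊗ c) = Λ₍₁₎ a ⊗ Λ₍₂₎ b S(c)` is evaluated on the two bracketings of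
  -- `h₍₁₎ ⊗ h₍₂₎ ⊗ h₍₃₎`.
  let T : H ⊗[k] (H ⊗[k] H) →ₗ[k] H ⊗[k] H := ∑ i ∈ r.index,
    TensorProduct.map (LinearMap.mulLeft k (r.left i))
      (LinearMap.mulLeft k (r.right i) ∘ₗ LinearMap.mul' k H ∘ₗ
        TensorProduct.map LinearMap.id (antipode k))
  have key := congrArg T
    (sum_tmul_tmul_eq s (fun j => ℛ k (s.left j)) (fun j => ℛ k (s.right j)))
  have hR : T (∑ j ∈ s.index, ∑ m ∈ (ℛ k (s.right j)).index,
      s.left j ⊗ₜ[k] ((ℛ k (s.right j)).left m ⊗ₜ[k] (ℛ k (s.right j)).right m)) =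
      TensorProduct.map (LinearMap.mulRight k h) LinearMap.id (comul (R := k) Λ) := by
    have hc := sum_counit_right_smul_left s
    simp only [T, LinearMap.sum_apply, map_sum, TensorProduct.map_tmul,
      LinearMap.comp_apply, LinearMap.mul'_apply, LinearMap.id_apply, LinearMap.mulLeft_apply]
    rw [← r.eq]
    simp only [map_sum, TensorProduct.map_tmul, LinearMap.mulRight_apply, LinearMap.id_apply]
    rw [Finset.sum_congr rfl fun _ _ => Finset.sum_comm, Finset.sum_comm]
    refine Finset.sum_congr rfl fun i _ => ?_
    simp only [← TensorProduct.tmul_sum, ← Finset.mul_sum, sum_mul_antipode_eq_smul,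
      mul_smul_comm, mul_one, TensorProduct.tmul_smul, TensorProduct.smul_tmul']
    conv_rhs => rw [← hc]
    simp only [Finset.mul_sum, TensorProduct.sum_tmul, mul_smul_comm]
  have hL : T (∑ j ∈ s.index, ∑ m ∈ (ℛ k (s.left j)).index,
      (ℛ k (s.left j)).left m ⊗ₜ[k] ((ℛ k (s.left j)).right m ⊗ₜ[k] s.right j)) =
      TensorProduct.map LinearMap.id (LinearMap.mulRight k (antipode k h))
        (comul (R := k) Λ) := by
    have hj : ∀ j, T (∑ m ∈ (ℛ k (s.left j)).index,
        (ℛ k (s.left j)).left m ⊗ₜ[k] ((ℛ k (s.left j)).right m ⊗ₜ[k] s.right j)) =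
        counit (R := k) (s.left j) • TensorProduct.map LinearMap.id
          (LinearMap.mulRight k (antipode k (s.right j))) (comul (R := k) Λ) := by
      intro j
      rw [← LinearMap.map_smul, ← LinearMap.map_smul, ← hΛ, Bialgebra.comul_mul,
        ← (ℛ k (s.left j)).eq, ← r.eq]
      simp only [T, LinearMap.sum_apply, map_sum, TensorProduct.map_tmul,
        LinearMap.mulRight_apply, Finset.sum_mul, Finset.mul_sum,
        Algebra.TensorProduct.tmul_mul_tmul,
        LinearMap.comp_apply, LinearMap.mul'_apply, LinearMap.id_apply, LinearMap.mulLeft_apply,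
        mul_assoc]
    have hc : ∑ j ∈ s.index, (counit (R := k) (s.left j)) • s.right j = h := sum_counit_smul s
    rw [map_sum]
    simp only [hj]
    rw [← r.eq]
    simp only [map_sum, TensorProduct.map_tmul, LinearMap.mulRight_apply, Finset.smul_sum,
      LinearMap.id_apply]
    rw [Finset.sum_comm]
    refine Finset.sum_congr rfl fun i _ => ?_
    conv_rhs => rw [← hc]
    rw [map_sum, Finset.mul_sum, TensorProduct.tmul_sum]
    simp
  rw [← hR, ← hL, key]

section Semisimple

variable [IsSemisimpleRing H]

/-- If `ε(Λ) = 0` then `Λ h Λ = ε(h) ε(Λ) Λ = 0` for all `h`. -/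
theorem IsLeftIntegral.counit_ne_zero (hΛ : IsLeftIntegral k Λ) (h0 : Λ ≠ 0) :
    counit (R := k) Λ ≠ 0 := by
  intro hc
  refine h0 (eq_zero_of_forall_mul_mul_eq_zero fun h => ?_)
  rw [mul_assoc, hΛ, mul_smul_comm, hΛ, hc, zero_smul, smul_zero]

/-- A semisimple Hopf algebra is unimodular: `Λ h - ε(h) Λ` is a left integral on which the counit
vanishes. -/
theorem IsLeftIntegral.mul_eq (hΛ : IsLeftIntegral k Λ) (h : H) :
    Λ * h = counit (R := k) h • Λ := by
  have hd : IsLeftIntegral k (Λ * h - counit (R := k) h • Λ) := fun x => by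
    rw [mul_sub, ← mul_assoc, hΛ, mul_smul_comm, hΛ, smul_mul_assoc, smul_sub, smul_comm]
  by_contra hne
  refine hd.counit_ne_zero (sub_ne_zero.2 hne) ?_
  simp [mul_comm]

/-- `S(Λ₍₂₎) Λ₍₁₎` intertwines the identity and the square of the antipode. -/
theorem IsLeftIntegral.antipodeMulSwap_mul (hΛ : IsLeftIntegral k Λ) (h : H) :
    antipodeMulSwap k Λ * h = antipode k (antipode k h) * antipodeMulSwap k Λ := by
  let r := ℛ k Λ
  have key := congrArg (LinearMap.mul' k H ∘ₗ (TensorProduct.comm k H H).toLinearMap ∘ₗ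
    TensorProduct.map LinearMap.id (antipode k)) (map_mulRight_of_isRightIntegral hΛ.mul_eq h)
  rw [← r.eq] at key
  rw [antipodeMulSwap_eq_sum k _ r, Finset.sum_mul, Finset.mul_sum]
  simpa [antipode_mul_antidistrib, mul_assoc] using key

end Semisimple

end HopfAlgebra

/-! ### The Casimir map of a module -/

section Casimir

open Coalgebra HopfAlgebra TensorProduct

variable {k H : Type*} [Field k] [Ring H] [HopfAlgebra k H] {Λ : H}
variable {V : Type*} [AddCommGroup V] [Module k V] [Module H V] [IsScalarTower k H V]

theorem casimirMap_eq_one (Λ : H) (u : Hˣ) (φ : Module.End k V) :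
    casimirMap Λ u φ = casimirMap Λ 1 (φ * Algebra.lsmul k k V ((u⁻¹ : Hˣ) : H)) := by
  ext v
  simp [casimirMap_apply Λ _ _ (ℛ k Λ), mul_smul]

/-- `Λ₍₁₎ φ S(Λ₍₂₎)` is `H`-linear, by the Casimir property. -/
theorem IsLeftIntegral.casimirMap_smul (hΛ : IsLeftIntegral k Λ) (φ : Module.End k V) (h : H)
    (v : V) : casimirMap Λ 1 φ (h • v) = h • casimirMap Λ 1 φ v := by
  let r := ℛ k Λ
  have key := congrArg (TensorProduct.lift
    ((LinearMap.mul k (Module.End k V)).compl₁₂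
      (Algebra.lsmul k k V : H →ₐ[k] Module.End k V).toLinearMap
      (LinearMap.mulLeft k φ ∘ₗ
        (Algebra.lsmul k k V : H →ₐ[k] Module.End k V).toLinearMap))) (hΛ.map_mulLeft h)
  rw [← r.eq] at key
  have := congr($key v)
  rw [casimirMap_apply _ _ _ r, casimirMap_apply _ _ _ r]
  simpa [mul_smul, Finset.smul_sum, LinearMap.sum_apply] using this.symm

theorem casimirMap_one_one (Λ : H) :
    casimirMap Λ 1 (1 : Module.End k V) = counit (R := k) Λ • 1 := by
  ext v
  rw [casimirMap_apply _ _ _ (ℛ k Λ)]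
  have := congrArg (· • v) (sum_mul_antipode_eq_smul (ℛ k Λ))
  simpa [Finset.sum_smul, mul_smul] using this

theorem trace_casimirMap (Λ : H) (φ : Module.End k V) :
    LinearMap.trace k V (casimirMap Λ 1 φ) =
      LinearMap.trace k V (φ * Algebra.lsmul k k V (antipodeMulSwap k Λ)) := by
  let r := ℛ k Λ
  have h1 : casimirMap Λ 1 φ = ∑ i ∈ r.index, Algebra.lsmul k k V (r.left i) *
      (φ * Algebra.lsmul k k V (antipode k (r.right i))) := by
    ext v
    simp [casimirMap_apply _ _ _ r, LinearMap.sum_apply]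
  rw [h1, antipodeMulSwap_eq_sum k _ r]
  simp only [map_sum, map_mul, Finset.mul_sum]
  refine Finset.sum_congr rfl fun i _ => ?_
  rw [LinearMap.trace_mul_comm, mul_assoc]

theorem trace_antipodeMulSwap (Λ : H) (V : Type*) [AddCommGroup V] [Module k V] [Module H V]
    [IsScalarTower k H V] [FiniteDimensional k V] :
    LinearMap.trace k V (Algebra.lsmul k k V (antipodeMulSwap k Λ)) =
      counit (R := k) Λ * Module.finrank k V := by
  have h := trace_casimirMap Λ (1 : Module.End k V)
  rwa [casimirMap_one_one, one_mul, map_smul, LinearMap.trace_one, smul_eq_mul, eq_comm] at h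

end Casimir

/-! ### Simple modules over an algebraically closed field -/

section SimpleModule

open Coalgebra HopfAlgebra

theorem finiteDimensional_of_isSimpleModule (k H V : Type*) [Field k] [Ring H] [Algebra k H]
    [FiniteDimensional k H] [AddCommGroup V] [Module k V] [Module H V] [IsScalarTower k H V]
    [IsSimpleModule H V] : FiniteDimensional k V :=
  Module.Finite.trans H V

open scoped Classical in
/-- The algebra map `H → End_k(V)` is surjective, by the density theorem and `End_H(V) = k`. -/
theorem finrank_sq_le_finrank (k H V : Type*) [Field k] [IsAlgClosed k] [Ring H] [Algebra k H]
    [FiniteDimensional k H] [AddCommGroup V] [Module k V] [Module H V] [IsScalarTower k H V]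
    [FiniteDimensional k V] [IsSimpleModule H V] :
    Module.finrank k V ^ 2 ≤ Module.finrank k H := by
  have hsurj : Function.Surjective (Algebra.lsmul k k V : H →ₐ[k] Module.End k V).toLinearMap := by
    intro φ
    let f : Module.End (Module.End H V) V :=
      { toFun := φ
        map_add' := φ.map_add
        map_smul' := fun g v => by
          obtain ⟨c, rfl⟩ :=
            (IsSimpleModule.algebraMap_end_bijective_of_isAlgClosed (A := H) (V := V) k).2 g
          simp }
    let b := Module.finBasis k V
    obtain ⟨r, hr⟩ := jacobson_density f (Finset.univ.image b)
    exact ⟨r, b.ext fun i => (hr (b i) (by simp)).symm⟩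
  have := LinearMap.finrank_le_finrank_of_surjective hsurj
  rwa [Module.finrank_linearMap, ← sq] at this

/-- The assumption on the characteristic enters here: `dim V ≤ √(dim H) < p`. -/
theorem finrank_cast_ne_zero (k H V : Type*) [Field k] [IsAlgClosed k] [Ring H] [Algebra k H]
    [FiniteDimensional k H] [AddCommGroup V] [Module k V] [Module H V] [IsScalarTower k H V]
    [IsSimpleModule H V] (p : ℕ) [CharP k p]
    (hp : p = 0 ∨ Real.sqrt (Module.finrank k H) < p) : (Module.finrank k V : k) ≠ 0 := by
  have := finiteDimensional_of_isSimpleModule k H V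
  have := IsSimpleModule.nontrivial H V
  have hpos : 0 < Module.finrank k V := Module.finrank_pos
  rw [Ne, CharP.cast_eq_zero_iff k p]
  rcases hp with rfl | hp
  · rw [zero_dvd_iff]; exact hpos.ne'
  · refine Nat.not_dvd_of_pos_of_lt hpos ?_
    have hle : (Module.finrank k V : ℝ) ≤ Real.sqrt (Module.finrank k H) :=
      Real.le_sqrt_of_sq_le (by exact_mod_cast finrank_sq_le_finrank k H V)
    exact_mod_cast hle.trans_lt hp

variable {k H : Type*} [Field k] [Ring H] [HopfAlgebra k H] [FiniteDimensional k H] {Λ : H}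
variable {V : Type*} [AddCommGroup V] [Module k V] [Module H V] [IsScalarTower k H V]
  [IsSimpleModule H V]

/-- Evaluating at `φ = 1` recovers `c`, because `tr(1) = dim V` is nonzero in `k`. -/
theorem IsSchurElement.unique (hd : (Module.finrank k V : k) ≠ 0) {u : Hˣ}
    {c c' : k} (hc : IsSchurElement V Λ u c) (hc' : IsSchurElement V Λ u c') : c = c' := by
  have := finiteDimensional_of_isSimpleModule k H V
  have := IsSimpleModule.nontrivial H V
  obtain ⟨v, hv⟩ := exists_ne (0 : V)
  have h := congr($((hc 1).symm.trans (hc' 1)) v)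
  rw [LinearMap.trace_one] at h
  exact mul_right_cancel₀ hd (smul_left_injective k hv h)

variable [IsAlgClosed k]

theorem IsLeftIntegral.exists_casimirMap_eq_smul (hΛ : IsLeftIntegral k Λ)
    (φ : Module.End k V) : ∃ c : k, casimirMap Λ 1 φ = c • (1 : Module.End k V) := by
  have := finiteDimensional_of_isSimpleModule k H V
  let g : Module.End H V :=
    { toFun := casimirMap Λ 1 φ
      map_add' := map_add _
      map_smul' := hΛ.casimirMap_smul φ }
  obtain ⟨c, hc⟩ := (IsSimpleModule.algebraMap_end_bijective_of_isAlgClosed k).2 g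
  exact ⟨c, LinearMap.ext fun v => congr($hc v).symm⟩

theorem exists_smul_eq_of_mem_center {z : H} (hz : z ∈ Subring.center H) :
    ∃ c : k, ∀ v : V, z • v = c • v := by
  have := finiteDimensional_of_isSimpleModule k H V
  let g : Module.End H V :=
    { toFun := fun v => z • v
      map_add' := smul_add z
      map_smul' := fun h v => by
        rw [RingHom.id_apply, ← mul_smul, ← mul_smul, Subring.mem_center_iff.1 hz] }
  obtain ⟨c, hc⟩ := (IsSimpleModule.algebraMap_end_bijective_of_isAlgClosed k).2 g
  exact ⟨c, fun v => congr($hc v).symm⟩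

/-- `S(Λ₍₂₎) Λ₍₁₎` acts nontrivially on every simple module, since its trace is `ε(Λ) dim V ≠ 0`.
So its right annihilator, which is a left ideal because `U h = S²(h) U`, contains no simple left
ideal. -/
theorem isUnit_antipodeMulSwap [IsSemisimpleRing H] (hΛ : IsLeftIntegral k Λ) (h0 : Λ ≠ 0)
    (p : ℕ) [CharP k p] (hp : p = 0 ∨ Real.sqrt (Module.finrank k H) < p) :
    IsUnit (antipodeMulSwap k Λ) := by
  set U := antipodeMulSwap k Λ with hU
  let N : Ideal H :=
    { carrier := {h | U * h = 0}
      add_mem' := fun {a b} ha hb => by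
        rw [Set.mem_ofPred_eq] at *
        rw [mul_add, ha, hb, add_zero]
      zero_mem' := mul_zero U
      smul_mem' := fun c h hh => by
        rw [Set.mem_ofPred_eq] at *
        rw [smul_eq_mul, ← mul_assoc, hΛ.antipodeMulSwap_mul, mul_assoc, hh, mul_zero] }
  have hN : N = ⊥ := by
    refine (IsSemisimpleModule.eq_bot_or_exists_simple_le N).resolve_right ?_
    rintro ⟨L, hLN, hL⟩
    have hzero : Algebra.lsmul k k L U = 0 := by
      ext l
      exact hLN l.2
    have := finiteDimensional_of_isSimpleModule k H L
    have htr := trace_antipodeMulSwap Λ L (k := k)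
    rw [← hU, hzero, map_zero, eq_comm, mul_eq_zero] at htr
    exact htr.elim (hΛ.counit_ne_zero h0) (finrank_cast_ne_zero k H L p hp)
  have hinj : Function.Injective (LinearMap.mulLeft k U) := by
    rw [← LinearMap.ker_eq_bot, LinearMap.ker_eq_bot']
    intro h hh
    have : h ∈ N := hh
    rwa [hN, Submodule.mem_bot] at this
  obtain ⟨w, hw⟩ := LinearMap.injective_iff_surjective.1 hinj 1
  have hw' : U * w = 1 := hw
  refine ⟨⟨U, w, hw', hinj ?_⟩, rfl⟩
  simp only [LinearMap.mulLeft_apply]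
  rw [← mul_assoc, hw', one_mul, mul_one]

/-- If the scalar `c` is `Λ₍₁₎ φ u⁻¹ S(Λ₍₂₎)`, then
`c dim V = tr(φ u⁻¹ S(Λ₍₂₎) Λ₍₁₎) = ζ tr(φ)`. -/
theorem isSchurElement_of_smul_eq (hΛ : IsLeftIntegral k Λ) (u : Hˣ)
    (hd : (Module.finrank k V : k) ≠ 0) {ζ : k}
    (hζ : ∀ v : V, (((u⁻¹ : Hˣ) : H) * antipodeMulSwap k Λ) • v = ζ • v) :
    IsSchurElement V Λ u (ζ / Module.finrank k V) := by
  have := finiteDimensional_of_isSimpleModule k H V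
  intro φ
  obtain ⟨c, hc⟩ := hΛ.exists_casimirMap_eq_smul (φ * Algebra.lsmul k k V ((u⁻¹ : Hˣ) : H))
  have hz : Algebra.lsmul k k V ((u⁻¹ : Hˣ) : H) * Algebra.lsmul k k V (antipodeMulSwap k Λ) =
      ζ • (1 : Module.End k V) := by
    rw [← map_mul]
    exact LinearMap.ext hζ
  have htr := trace_casimirMap Λ (φ * Algebra.lsmul k k V ((u⁻¹ : Hˣ) : H))
  rw [hc, mul_assoc, hz, map_smul, LinearMap.trace_one, mul_smul_comm, mul_one, map_smul,
    smul_eq_mul, smul_eq_mul] at htr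
  rw [casimirMap_eq_one, hc, div_mul_eq_mul_div, ← htr, mul_div_cancel_right₀ _ hd]
  rfl

end SimpleModule

/-- If conjugation by `u` is `f` and `w` intertwines the identity and `f`, then `u⁻¹ w` is central. -/
theorem inv_mul_mem_center {H : Type*} [Ring H] (f : H → H) (u : Hˣ) {w : H}
    (hu : ∀ h, f h = u * h * (u⁻¹ : Hˣ)) (hw : ∀ h, w * h = f h * w) :
    ((u⁻¹ : Hˣ) : H) * w ∈ Subring.center H := by
  refine Subring.mem_center_iff.2 fun h => ?_
  rw [mul_assoc, hw, hu]
  simp [mul_assoc]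

end HopfSchur

/-! ### Schur elements and the square of the antipode -/

open HopfSchur in
theorem mainTheorem3 {k H : Type*} [Field k] [IsAlgClosed k] [Ring H] [HopfAlgebra k H]
    [FiniteDimensional k H] [IsSemisimpleRing H]
    (p : ℕ) [CharP k p] (hp : p = 0 ∨ Real.sqrt (Module.finrank k H) < p)
    (Λ : H) (hΛ : HopfSchur.IsLeftIntegral k Λ)
    (lam : Module.Dual k H) (hlam : HopfSchur.IsRightIntegralDual lam) (hone : lam Λ = 1)
    {ι : Type*} [Fintype ι] (V : ι → Type*)
    [∀ i, AddCommGroup (V i)] [∀ i, Module k (V i)] [∀ i, Module H (V i)]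
    [∀ i, IsScalarTower k H (V i)]
    (hV : HopfSchur.IsCompleteSimpleFamily H V)
    (e : ι → H) (he : ∀ i, HopfSchur.IsCentralPrimitiveIdempotent (e i))
    (heV : ∀ i, ∀ v : V i, e i • v = v) :
    (∃ w : Hˣ, (w : H) = HopfSchur.antipodeMulSwap k Λ ∧
      ∀ h : H, HopfAlgebra.antipode k (HopfAlgebra.antipode k h) = w * h * (w⁻¹ : Hˣ)) ∧
    ∀ u : Hˣ,
      (∀ h : H, HopfAlgebra.antipode k (HopfAlgebra.antipode k h) = u * h * (u⁻¹ : Hˣ)) →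
      (∀ i, ∃! c : k, HopfSchur.IsSchurElement (V i) Λ u c) ∧
      ∀ c : ι → k, (∀ i, HopfSchur.IsSchurElement (V i) Λ u (c i)) →
        HopfSchur.antipodeMulSwap k Λ =
          u * ∑ i, ((Module.finrank k (V i) : k) * c i) • e i := by
  have h0 : Λ ≠ 0 := by
    rintro rfl
    simp at hone
  have hsimple := hV.simple
  have hd : ∀ i, (Module.finrank k (V i) : k) ≠ 0 := fun i =>
    finrank_cast_ne_zero k H (V i) p hp
  refine ⟨?_, fun u hu => ?_⟩
  · obtain ⟨w, hw⟩ := isUnit_antipodeMulSwap hΛ h0 p hp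
    refine ⟨w, hw, fun h => ?_⟩
    rw [hw, hΛ.antipodeMulSwap_mul, ← hw, Units.mul_inv_cancel_right]
  have hz := inv_mul_mem_center _ u hu hΛ.antipodeMulSwap_mul
  choose ζ hζ using fun i => exists_smul_eq_of_mem_center (k := k) (V := V i) hz
  have hschur : ∀ i, IsSchurElement (V i) Λ u (ζ i / Module.finrank k (V i)) := fun i =>
    isSchurElement_of_smul_eq hΛ u (hd i) (hζ i)
  have hunique : ∀ i c, IsSchurElement (V i) Λ u c → c = ζ i / Module.finrank k (V i) :=
    fun i c hc => hc.unique (hd i) (hschur i)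
  refine ⟨fun i => ⟨_, hschur i, hunique i⟩, fun c hc => ?_⟩
  have hcoef : ∀ i, (Module.finrank k (V i) : k) * c i = ζ i := fun i => by
    rw [hunique i _ (hc i), mul_div_cancel₀ _ (hd i)]
  have hV0 : ∀ j (v : V j), (∑ i, ((Module.finrank k (V i) : k) * c i) • e i) • v = ζ j • v := by
    intro j v
    rw [Finset.sum_smul, Finset.sum_eq_single j]
    · rw [smul_assoc, heV, hcoef]
    · intro i _ hij
      rw [smul_assoc, (he i).smul_eq_zero (heV i) ⟨fun f => hij (hV.not_iso i j ⟨f⟩)⟩, smul_zero]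
    · simp
  have hmain : ((u⁻¹ : Hˣ) : H) * antipodeMulSwap k Λ =
      ∑ i, ((Module.finrank k (V i) : k) * c i) • e i := by
    rw [← sub_eq_zero]
    refine eq_zero_of_forall_simple_smul_eq_zero fun L hL l hl => ?_
    obtain ⟨j, ⟨f⟩⟩ := hV.complete L hL
    have : (((u⁻¹ : Hˣ) : H) * antipodeMulSwap k Λ -
        ∑ i, ((Module.finrank k (V i) : k) * c i) • e i) • (⟨l, hl⟩ : L) = 0 := by
      apply f.injective
      rw [map_smul, map_zero, sub_smul, hV0, hζ, sub_self]
    exact congrArg Subtype.val this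
  rw [← hmain, Units.mul_inv_cancel_left]
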